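/- Write $(a;q)_0=1$, $(a;q)_k=(1-a)(1-aq)\cdots(1-aq^{k-1})$ for $k\geqslant 1$, and $[m]=1+q+\cdots+q^{m-1}$, and let $\Phi_n(q)$ be the $n$-th cyclotomic polynomial. For rational functions $A(q),B(q)\in\mathbb{Q}(q)$ and a polynomial $P(q)\in\mathbb{Q}[q]$, $A(q)\equiv B(q)\pmod{P(q)}$ means that $P(q)$ divides the numerator of $A(q)-B(q)$ written in lowest terms. Let $n$ be a positive odd integer, and for $k\geqslant 0$ let $$c_q(k)=\frac{(q;q^2)_k^2(q^2;q^4)_k}{(q^2;q^2)_k^2(q^4;q^4)_k}q^{2k}.$$ Then, modulo $\Phi_n(q)^3$, $$\sum_{k=0}^{n-1}\sum_{j=0}^{k}c_q(j)c_q(k-j)\equiv\begin{cases}\dfrac{(q^2;q^4)_{(n-1)/4}^4}{(q^4;q^4)_{(n-1)/4}^4}\,q^{n-1}\left(1+4[n]^2\displaystyle\sum_{k=1}^{(n-1)/4}\frac{q^{4k-2}}{[4k-2]^2}\right)&\text{if } n\equiv1\pmod 4,\\[10pt] 0&\text{if } n\equiv3\pmod 4.\end{cases}$$ -/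

import Mathlib

open Polynomial

/-- The `q`-shifted factorial `(a; q)_k = (1 - a)(1 - a q) ⋯ (1 - a q^(k-1))`. -/
def qPochhammer {F : Type*} [Field F] (a q : F) (k : ℕ) : F :=
  ∏ i ∈ Finset.range k, (1 - a * q ^ i)

/-- The `q`-integer `[m] = 1 + q + ⋯ + q^(m-1)`. -/
def qInt {F : Type*} [Field F] (q : F) (m : ℕ) : F :=
  ∑ i ∈ Finset.range m, q ^ i

/-- The term
`c_q(k) = (q;q^2)_k^2 (q^2;q^4)_k q^(2k) / ((q^2;q^2)_k^2 (q^4;q^4)_k)`. -/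
def cTerm {F : Type*} [Field F] (q : F) (k : ℕ) : F :=
  (qPochhammer q (q ^ 2) k ^ 2 * qPochhammer (q ^ 2) (q ^ 4) k) /
    (qPochhammer (q ^ 2) (q ^ 2) k ^ 2 * qPochhammer (q ^ 4) (q ^ 4) k) * q ^ (2 * k)

/-- Congruence of rational functions modulo a polynomial: `A ≡ B (mod P)` when `P` divides the
numerator of `A - B` written in lowest terms. -/
def RatFuncCongr (P : ℚ[X]) (A B : RatFunc ℚ) : Prop :=
  P ∣ (A - B).num

/-! Deform `(q;q^2)_k^2` to `(aq;q^2)_k (q/a;q^2)_k`. The half-length sum then becomes a polynomial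
F(u) in u = 2 - a - 1/a (`seriesPoly`), and a = 1 gives S = F(0). For (n-1)/2 < k < n the term
c_q(k) is divisible by Φ_n^3, so the truncated convolution is congruent to S^2
(`doubleSum_localCongr`).

At a = q^n one has u = -(1-q^n)^2/q^n, divisible by Φ_n^2, so F(u) = F(0) + F'(0)u modulo Φ_n^4. The
left side is known exactly: a contiguous relation links a = bq^2 to a = b/q^2, and its boundary term
vanishes at suitable odd powers of q. This gives a product for exponents 1 mod 4 and zero for
exponents 3 mod 4.

If n ≡ 3 (mod 4), Φ_n^2 divides S, hence S^2 vanishes. If n ≡ 1 (mod 4), F'(0) is needed only modulo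
Φ_n. At a primitive root of unity ζ, interpolation shows that F is a constant times an explicit
product of squared linear factors (`seriesPoly_eq_C_mul_doubleStepPoly`). Its logarithmic derivative
at 0 is twice the sum in the theorem, and squaring S turns this 2 into the 4. -/

/-- The part `(q^2;q^4)_k / ((q^2;q^2)_k^2 (q^4;q^4)_k)` of `cTerm q k`. -/
def qWeight {F : Type*} [Field F] (q : F) (k : ℕ) : F :=
  qPochhammer (q ^ 2) (q ^ 4) k /
    (qPochhammer (q ^ 2) (q ^ 2) k ^ 2 * qPochhammer (q ^ 4) (q ^ 4) k)

/-- The linear polynomial `(1 - q^j)^2 + q^j u` in `u`; at `u = 2 - a - a⁻¹` it equals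
`(1 - a q^j) (1 - q^j / a)`. -/
noncomputable def pairFactor {F : Type*} [Field F] (q : F) (j : ℕ) : F[X] :=
  C ((1 - q ^ j) ^ 2) + C (q ^ j) * X

/-- The truncated series `∑ (aq;q^2)_k (q/a;q^2)_k (q^2;q^4)_k q^(2k) / ((q^2;q^2)_k^2 (q^4;q^4)_k)`
over `k < K`, as a polynomial in `u = 2 - a - a⁻¹`. -/
noncomputable def seriesPoly {F : Type*} [Field F] (q : F) (K : ℕ) : F[X] :=
  ∑ k ∈ Finset.range K, C (qWeight q k * q ^ (2 * k)) *
    ∏ i ∈ Finset.range k, pairFactor q (2 * i + 1)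

/-! ### The deformed series and its terminating values -/

section Field

variable {F : Type*} [Field F]

/-- The product `(aq;q^2)_k (q/a;q^2)_k`. -/
def pairProd (q a : F) (k : ℕ) : F :=
  ∏ i ∈ Finset.range k, ((1 - a * q ^ (2 * i + 1)) * (1 - a⁻¹ * q ^ (2 * i + 1)))

lemma eval_pairFactor (q : F) (j : ℕ) {a : F} (ha : a ≠ 0) :
    (pairFactor q j).eval (2 - a - a⁻¹) = (1 - a * q ^ j) * (1 - a⁻¹ * q ^ j) := by
  simp only [pairFactor, eval_add, eval_C, eval_mul, eval_X]
  field_simp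
  ring

lemma eval_seriesPoly (q : F) (K : ℕ) {a : F} (ha : a ≠ 0) :
    (seriesPoly q K).eval (2 - a - a⁻¹) =
      ∑ k ∈ Finset.range K, qWeight q k * q ^ (2 * k) * pairProd q a k := by
  simp only [seriesPoly, eval_finsetSum, eval_mul, eval_C, eval_prod, eval_pairFactor q _ ha,
    pairProd]

lemma pairProd_inv (q a : F) (k : ℕ) : pairProd q a⁻¹ k = pairProd q a k := by
  simp only [pairProd, inv_inv]
  exact Finset.prod_congr rfl fun _ _ => mul_comm _ _

lemma pairProd_succ (q a : F) (k : ℕ) : pairProd q a (k + 1) =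
    pairProd q a k * ((1 - a * q ^ (2 * k + 1)) * (1 - a⁻¹ * q ^ (2 * k + 1))) :=
  Finset.prod_range_succ _ _

/-- Shifting `b` by `q^2` moves each of the two products by one step. The stray factor `1 - 1/(bq)`
equals `-(1 - bq)/(bq)` and supplies the missing initial factor `1 - bq`. -/
lemma mul_pairProd_shift {q b : F} (hq : q ≠ 0) (hb : b ≠ 0) (k : ℕ) :
    b * q * pairProd q (b * q ^ 2) (k + 1) =
      -((1 - b * q ^ (2 * k + 1)) * (1 - b * q ^ (2 * k + 3)) * pairProd q b k) := by
  induction k with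
  | zero => simp [pairProd]; field_simp; ring
  | succ k ih =>
    rw [pairProd_succ, ← mul_assoc, ih, pairProd_succ]
    have h : (b * q ^ 2)⁻¹ * q ^ (2 * (k + 1) + 1) = b⁻¹ * q ^ (2 * k + 1) := by
      field_simp; ring
    rw [h]
    ring

lemma qWeight_succ_mul {q : F} {k : ℕ} (h : q ^ (4 * (k + 1)) ≠ 1) :
    qWeight q (k + 1) * ((1 - q ^ (2 * k + 2)) ^ 2 * (1 - q ^ (4 * k + 4))) =
      qWeight q k * (1 - q ^ (4 * k + 2)) := by
  have h4 : (1 - q ^ (4 * k + 4)) ≠ 0 := sub_ne_zero.2 fun e => h (by rw [mul_add]; exact e.symm)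
  have h2 : (1 - q ^ (2 * k + 2)) ≠ 0 := by
    refine fun e => h4 ?_
    have : (1 - q ^ (4 * k + 4)) = (1 - q ^ (2 * k + 2)) * (1 + q ^ (2 * k + 2)) := by ring
    rw [this, e, zero_mul]
  have e1 : q ^ 2 * (q ^ 4) ^ k = q ^ (4 * k + 2) := by ring
  have e2 : q ^ 2 * (q ^ 2) ^ k = q ^ (2 * k + 2) := by ring
  have e3 : q ^ 4 * (q ^ 4) ^ k = q ^ (4 * k + 4) := by ring
  simp only [qWeight, qPochhammer, Finset.prod_range_succ, e1, e2, e3]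
  rw [div_mul_eq_mul_div, div_mul_eq_mul_div, mul_pow]
  rw [show ∀ x y z w : F, x ^ 2 * z ^ 2 * (y * w) = (x ^ 2 * y) * (z ^ 2 * w) by intros; ring]
  rw [mul_div_mul_right _ _ (mul_ne_zero (pow_ne_zero 2 h2) h4)]

/-- A contiguous relation for the truncated series, in telescoped form. -/
lemma seriesPoly_contiguous {q b : F} (hq : q ≠ 0) (hb : b ≠ 0) {K : ℕ}
    (hK : ∀ i, 1 ≤ i → i ≤ K → q ^ (4 * i) ≠ 1) :
    (1 - b * q) ^ 2 * (seriesPoly q (K + 1)).eval (2 - b * q ^ 2 - (b * q ^ 2)⁻¹) -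
      (q - b) ^ 2 * (seriesPoly q (K + 1)).eval (2 - b / q ^ 2 - (b / q ^ 2)⁻¹) =
      (1 - b ^ 2) * (pairProd q b K * qWeight q K * (1 - q ^ (4 * K + 2))) := by
  have hA : b * q ^ 2 ≠ 0 := by positivity
  have hB : b / q ^ 2 ≠ 0 := by positivity
  rw [eval_seriesPoly q _ hA, eval_seriesPoly q _ hB]
  induction K with
  | zero => simp [pairProd, qWeight, qPochhammer]; ring
  | succ K ih =>
    have ih := ih fun i h1 h2 => hK i h1 (by omega)
    rw [Finset.sum_range_succ, Finset.sum_range_succ _ (K + 1), mul_add ((1 - b * q) ^ 2)]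
    have hw := qWeight_succ_mul (hK (K + 1) (by omega) le_rfl)
    have s1 := mul_pairProd_shift hq hb K
    -- The downward shift is the upward one for `b⁻¹`, by the symmetry a ↦ 1/a.
    have s2 := mul_pairProd_shift hq (inv_ne_zero hb) K
    rw [pairProd_inv, show b⁻¹ * q ^ 2 = (b / q ^ 2)⁻¹ by field_simp, pairProd_inv] at s2
    have s1' : pairProd q (b * q ^ 2) (K + 1) =
      -((1 - b * q ^ (2 * K + 1)) * (1 - b * q ^ (2 * K + 3)) * pairProd q b K) / (b * q) := by
      rw [← s1]; field_simp
    have s2' : pairProd q (b / q ^ 2) (K + 1) =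
      -((1 - b⁻¹ * q ^ (2 * K + 1)) * (1 - b⁻¹ * q ^ (2 * K + 3)) * pairProd q b K) * b / q := by
      rw [← s2]; field_simp
    -- With `hw`, the boundary term at `K` and the new summands all become multiples of `pairProd q
    -- b K * qWeight q (K + 1)`, leaving a rational identity.
    rw [mul_assoc (pairProd q b K), ← hw] at ih
    rw [mul_add ((q - b) ^ 2), add_sub_add_comm, ih, s1', s2', pairProd_succ]
    field_simp
    ring

lemma seriesPoly_eval_initial {q : F} (hq : q ≠ 0) (K : ℕ) :
    (seriesPoly q (K + 1)).eval (2 - q ^ 1 - (q ^ 1)⁻¹) = 1 := by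
  rw [eval_seriesPoly q _ (pow_ne_zero 1 hq), Finset.sum_range_succ']
  rw [Finset.sum_eq_zero]
  · simp [pairProd, qWeight, qPochhammer]
  · intro k _
    have : pairProd q (q ^ 1) (k + 1) = 0 :=
      Finset.prod_eq_zero (i := 0) (by simp) (by simp [hq])
    rw [this, mul_zero]

/-- Only the terms k = 0 and k = 1 survive, and they are 1 and -1. -/
lemma seriesPoly_eval_cube {q : F} (hq : q ≠ 0) (h : q ^ 4 ≠ 1) (K : ℕ) :
    (seriesPoly q (K + 2)).eval (2 - q ^ 3 - (q ^ 3)⁻¹) = 0 := by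
  rw [eval_seriesPoly q _ (pow_ne_zero 3 hq), Finset.sum_range_succ', Finset.sum_range_succ']
  rw [Finset.sum_eq_zero]
  · have hw := qWeight_succ_mul (q := q) (k := 0) (by simpa using h)
    simp [qWeight, qPochhammer] at hw ⊢
    have h4 : 1 - q ^ 4 ≠ 0 := sub_ne_zero.2 (Ne.symm h)
    have h2 : 1 - q ^ 2 ≠ 0 := by
      refine fun e => h4 ?_
      have : 1 - q ^ 4 = (1 - q ^ 2) * (1 + q ^ 2) := by ring
      rw [this, e, zero_mul]
    simp [pairProd]
    field_simp
    ring
  · intro k _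
    have : pairProd q (q ^ 3) (k + 1 + 1) = 0 :=
      Finset.prod_eq_zero (i := 1) (by simp) (by simp [hq])
    rw [this, mul_zero]

/-- This is the contiguous relation at `b = q^(2m+3)`, where the factor of index `m + 1` kills the
boundary term. The bound `m + 2 ≤ N` keeps that factor inside the product. -/
lemma seriesPoly_eval_step {q : F} (hq : q ≠ 0) {N m : ℕ} (hm : m + 2 ≤ N)
    (hN : ∀ i, 1 ≤ i → i ≤ N → q ^ (4 * i) ≠ 1) :
    (1 - q ^ (2 * m + 4)) ^ 2 *
        (seriesPoly q (N + 1)).eval (2 - q ^ (2 * m + 5) - (q ^ (2 * m + 5))⁻¹) =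
      q ^ 2 * (1 - q ^ (2 * m + 2)) ^ 2 *
        (seriesPoly q (N + 1)).eval (2 - q ^ (2 * m + 1) - (q ^ (2 * m + 1))⁻¹) := by
  have h := seriesPoly_contiguous hq (pow_ne_zero (2 * m + 3) hq) hN
  have h0 : pairProd q (q ^ (2 * m + 3)) N = 0 :=
    Finset.prod_eq_zero (i := m + 1) (Finset.mem_range.2 (by omega))
      (by rw [show 2 * (m + 1) + 1 = 2 * m + 3 by ring]; simp [hq])
  rw [h0, zero_mul, zero_mul, mul_zero, ← pow_add, sub_eq_zero,
    show q ^ (2 * m + 3) / q ^ 2 = q ^ (2 * m + 1) by field_simp; ring] at h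
  rw [show q ^ (2 * m + 4) = q ^ (2 * m + 3) * q by ring, show 2 * m + 5 = 2 * m + 3 + 2 by ring, h]
  ring

/-- A terminating `q`-analogue of Whipple's sum, even case. -/
lemma seriesPoly_eval_even {q : F} (hq : q ≠ 0) {N : ℕ}
    (hN : ∀ i, 1 ≤ i → i ≤ N → q ^ (4 * i) ≠ 1) (j : ℕ) (hj : 2 * j ≤ N) :
    (seriesPoly q (N + 1)).eval (2 - q ^ (4 * j + 1) - (q ^ (4 * j + 1))⁻¹) =
      qPochhammer (q ^ 2) (q ^ 4) j ^ 2 / qPochhammer (q ^ 4) (q ^ 4) j ^ 2 * q ^ (2 * j) := by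
  induction j with
  | zero => simpa [qPochhammer] using seriesPoly_eval_initial hq N
  | succ j ih =>
    have ih := ih (by omega)
    have h := seriesPoly_eval_step hq (m := 2 * j) (by omega) hN
    have h4 : 1 - q ^ (4 * j + 4) ≠ 0 :=
      sub_ne_zero.2 fun e => hN (j + 1) (by omega) (by omega) (by rw [mul_add]; exact e.symm)
    rw [show 2 * (2 * j) = 4 * j by ring, ih] at h
    have e1 : q ^ 2 * (q ^ 4) ^ j = q ^ (4 * j + 2) := by ring
    have e3 : q ^ 4 * (q ^ 4) ^ j = q ^ (4 * j + 4) := by ring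
    rw [show 4 * (j + 1) + 1 = 4 * j + 5 by ring]
    simp only [qPochhammer, Finset.prod_range_succ, e1, e3] at h ⊢
    refine mul_left_cancel₀ (pow_ne_zero 2 h4) (h.trans ?_)
    rw [mul_pow, mul_pow, mul_div_mul_comm]
    have := pow_ne_zero 2 h4
    rw [div_eq_mul_inv ((1 - q ^ (4 * j + 2)) ^ 2)]
    linear_combination -(q ^ (2 * j + 2) * (1 - q ^ (4 * j + 2)) ^ 2 *
      ((∏ x ∈ Finset.range j, (1 - q ^ 2 * (q ^ 4) ^ x)) ^ 2 /
        (∏ x ∈ Finset.range j, (1 - q ^ 4 * (q ^ 4) ^ x)) ^ 2)) * mul_inv_cancel₀ this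

/-- A terminating `q`-analogue of Whipple's sum, odd case. -/
lemma seriesPoly_eval_odd {q : F} (hq : q ≠ 0) {N : ℕ}
    (hN : ∀ i, 1 ≤ i → i ≤ N → q ^ (4 * i) ≠ 1) (j : ℕ) (hj : 2 * j + 1 ≤ N) :
    (seriesPoly q (N + 1)).eval (2 - q ^ (4 * j + 3) - (q ^ (4 * j + 3))⁻¹) = 0 := by
  induction j with
  | zero =>
    obtain ⟨K, rfl⟩ : ∃ K, N = K + 1 := ⟨N - 1, by omega⟩
    exact seriesPoly_eval_cube hq (by simpa using hN 1 le_rfl (by omega)) K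
  | succ j ih =>
    have ih := ih (by omega)
    have h := seriesPoly_eval_step hq (m := 2 * j + 1) (by omega) hN
    rw [show 2 * (2 * j + 1) + 1 = 4 * j + 3 by ring, ih, mul_zero] at h
    rw [show 4 * (j + 1) + 3 = 2 * (2 * j + 1) + 5 by ring]
    refine (mul_eq_zero.1 h).resolve_left (pow_ne_zero 2 (sub_ne_zero.2 fun e => ?_))
    refine hN (2 * j + 3) (by omega) (by omega) ?_
    -- The hypothesis concerns exponents divisible by 4, so the relation for `4j + 6` is squared.
    rw [show 4 * (2 * j + 3) = (2 * (2 * j + 1) + 4) * 2 by ring, pow_mul, ← e, one_pow]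

lemma natDegree_pairFactor_le (q : F) (j : ℕ) : (pairFactor q j).natDegree ≤ 1 := by
  unfold pairFactor; compute_degree

lemma natDegree_seriesPoly_le (q : F) (N : ℕ) : (seriesPoly q (N + 1)).natDegree ≤ N := by
  refine natDegree_sum_le_of_forall_le _ _ fun k hk => ?_
  refine (natDegree_C_mul_le _ _).trans ((natDegree_prod_le _ _).trans ?_)
  refine (Finset.sum_le_card_nsmul _ _ 1 fun i _ => natDegree_pairFactor_le q _).trans ?_
  simp at hk ⊢
  omega

/-- The point u = 0 is a = 1, where the deformation disappears. -/
lemma coeff_zero_seriesPoly (q : F) (K : ℕ) :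
    (seriesPoly q K).coeff 0 = ∑ k ∈ Finset.range K, cTerm q k := by
  rw [coeff_zero_eq_eval_zero, seriesPoly, eval_finsetSum]
  refine Finset.sum_congr rfl fun k _ => ?_
  have : qPochhammer q (q ^ 2) k = ∏ i ∈ Finset.range k, (1 - q ^ (2 * i + 1)) :=
    Finset.prod_congr rfl fun i _ => by ring
  simp only [cTerm, qWeight, eval_mul, eval_C, eval_prod, pairFactor, eval_add, eval_X, mul_zero,
    add_zero, this, Finset.prod_pow]
  ring

/-! ### The product that models the series at a root of unity -/

/-- The product of `(1 - a q^(4k+2)) (1 - q^(4k+2) / a)` over `k < M`. -/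
def doubleStepProd (q a : F) (M : ℕ) : F :=
  ∏ k ∈ Finset.range M, ((1 - a * q ^ (4 * k + 2)) * (1 - a⁻¹ * q ^ (4 * k + 2)))

/-- The quotient of the two products telescopes to end factors. Denominators are cleared so that no
nonvanishing of these factors is needed. -/
lemma doubleStepProd_shift {q a : F} (hq : q ≠ 0) (ha : a ≠ 0) (M : ℕ) :
    doubleStepProd q (a * q ^ 4) M * (a * q ^ 4 * (1 - a * q ^ 2) * (a * q ^ 2 - q ^ (4 * M))) =
      doubleStepProd q a M * (a * q ^ 4 * (1 - a * q ^ (4 * M + 2)) * (a * q ^ 2 - 1)) := by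
  induction M with
  | zero => simp [doubleStepProd]
  | succ M ih =>
    simp only [doubleStepProd, Finset.prod_range_succ] at ih ⊢
    have h : 1 - (a * q ^ 4)⁻¹ * q ^ (4 * M + 2) = (a * q ^ 2 - q ^ (4 * M)) / (a * q ^ 2) := by
      field_simp
      ring
    have h' : 1 - a⁻¹ * q ^ (4 * M + 2) = (a * q ^ 2 - q ^ (4 * (M + 1))) / (a * q ^ 2) := by
      field_simp; ring
    rw [h, h']
    linear_combination (1 - a * q ^ 4 * q ^ (4 * M + 2)) *
      (a * q ^ 2 - q ^ (4 * (M + 1))) / (a * q ^ 2) * ih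

/-- The polynomial in `u` whose value at `u = 2 - a - a⁻¹` is `doubleStepProd q a M ^ 2`. -/
noncomputable def doubleStepPoly (q : F) (M : ℕ) : F[X] :=
  ∏ k ∈ Finset.range M, pairFactor q (4 * k + 2) ^ 2

lemma eval_doubleStepPoly (q : F) (M : ℕ) {a : F} (ha : a ≠ 0) :
    (doubleStepPoly q M).eval (2 - a - a⁻¹) = doubleStepProd q a M ^ 2 := by
  simp only [doubleStepPoly, eval_prod, eval_pow, eval_pairFactor q _ ha, doubleStepProd,
    Finset.prod_pow]

lemma natDegree_doubleStepPoly_le (q : F) (M : ℕ) : (doubleStepPoly q M).natDegree ≤ 2 * M := by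
  refine (natDegree_prod_le _ _).trans ?_
  refine (Finset.sum_le_card_nsmul _ _ 2 fun i _ => ?_).trans ?_
  · exact (natDegree_pow_le_of_le 2 (natDegree_pairFactor_le q _)).trans (by norm_num)
  · simp [mul_comm]

/-- Logarithmic derivative at u = 0; the 2 comes from the squared factors. -/
lemma coeff_one_doubleStepPoly {q : F} {M : ℕ}
    (h : ∀ k, k < M → q ^ (4 * k + 2) ≠ 1) :
    (doubleStepPoly q M).coeff 1 = (doubleStepPoly q M).coeff 0 *
      (2 * ∑ k ∈ Finset.range M, q ^ (4 * k + 2) / (1 - q ^ (4 * k + 2)) ^ 2) := by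
  induction M with
  | zero => simp [doubleStepPoly, coeff_one]
  | succ M ih =>
    have ih := ih fun k hk => h k (by omega)
    have hM : 1 - q ^ (4 * M + 2) ≠ 0 := sub_ne_zero.2 (Ne.symm (h M (by omega)))
    simp only [doubleStepPoly, Finset.prod_range_succ, Finset.sum_range_succ] at ih ⊢
    rw [pow_two (pairFactor q (4 * M + 2))]
    have c0 : (pairFactor q (4 * M + 2)).coeff 0 = (1 - q ^ (4 * M + 2)) ^ 2 := by
      simp only [pairFactor, coeff_add, coeff_C_zero, coeff_C_mul, coeff_X_zero, mul_zero, add_zero]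
    have c1 : (pairFactor q (4 * M + 2)).coeff 1 = q ^ (4 * M + 2) := by
      simp only [pairFactor, coeff_add, coeff_C_succ, coeff_C_mul, coeff_X_one, mul_one, zero_add]
    have m1 : ∀ f g : F[X], (f * g).coeff 1 = f.coeff 0 * g.coeff 1 + f.coeff 1 * g.coeff 0 := by
      intro f g
      simp [coeff_mul, Finset.Nat.antidiagonal_succ]
    simp only [m1, mul_coeff_zero, c0, c1, ih]
    field_simp
    ring

end Field

/-! ### Regular rational functions at ζ and local congruences -/

/-- `A` is regular at `ζ`, with value `z`. -/
def ReducesTo (ζ : ℂ) (A : RatFunc ℚ) (z : ℂ) : Prop :=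
  ∃ p s : ℚ[X], aeval ζ s ≠ 0 ∧ algebraMap ℚ[X] (RatFunc ℚ) s * A = algebraMap _ _ p ∧
    aeval ζ s * z = aeval ζ p

namespace ReducesTo

variable {ζ : ℂ} {A B : RatFunc ℚ} {z w : ℂ}

lemma of_polynomial (p : ℚ[X]) : ReducesTo ζ (algebraMap _ _ p) (aeval ζ p) :=
  ⟨p, 1, by simp, by simp, by simp⟩

lemma X : ReducesTo ζ RatFunc.X ζ := by
  simpa [RatFunc.algebraMap_X] using of_polynomial (ζ := ζ) Polynomial.X

lemma zero : ReducesTo ζ 0 0 := by simpa using of_polynomial (ζ := ζ) 0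

lemma one : ReducesTo ζ 1 1 := by simpa using of_polynomial (ζ := ζ) 1

lemma two : ReducesTo ζ 2 2 := by
  simpa only [map_ofNat] using of_polynomial (ζ := ζ) 2

lemma add (hA : ReducesTo ζ A z) (hB : ReducesTo ζ B w) : ReducesTo ζ (A + B) (z + w) := by
  obtain ⟨p, s, hs, h1, h2⟩ := hA
  obtain ⟨p', s', hs', h1', h2'⟩ := hB
  refine ⟨p * s' + s * p', s * s', by simp [hs, hs'], ?_, ?_⟩
  · simp only [map_mul, map_add, ← h1, ← h1']; ring
  · simp only [map_mul, map_add, ← h2, ← h2']; ring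

lemma mul (hA : ReducesTo ζ A z) (hB : ReducesTo ζ B w) : ReducesTo ζ (A * B) (z * w) := by
  obtain ⟨p, s, hs, h1, h2⟩ := hA
  obtain ⟨p', s', hs', h1', h2'⟩ := hB
  refine ⟨p * p', s * s', by simp [hs, hs'], ?_, ?_⟩
  · simp only [map_mul, ← h1, ← h1']; ring
  · simp only [map_mul, ← h2, ← h2']; ring

lemma neg (hA : ReducesTo ζ A z) : ReducesTo ζ (-A) (-z) := by
  obtain ⟨p, s, hs, h1, h2⟩ := hA
  exact ⟨-p, s, hs, by simp [← h1], by simp [← h2]⟩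

lemma sub (hA : ReducesTo ζ A z) (hB : ReducesTo ζ B w) : ReducesTo ζ (A - B) (z - w) := by
  simpa only [sub_eq_add_neg] using hA.add hB.neg

lemma pow (hA : ReducesTo ζ A z) (k : ℕ) : ReducesTo ζ (A ^ k) (z ^ k) := by
  induction k with
  | zero => simpa using one
  | succ k ih => simpa only [pow_succ] using ih.mul hA

lemma inv (hA : ReducesTo ζ A z) (hz : z ≠ 0) : ReducesTo ζ A⁻¹ z⁻¹ := by
  obtain ⟨p, s, hs, h1, h2⟩ := hA
  have hp : aeval ζ p ≠ 0 := h2 ▸ mul_ne_zero hs hz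
  have hA : A ≠ 0 := by
    rintro rfl
    rw [mul_zero, eq_comm, map_eq_zero_iff _ (RatFunc.algebraMap_injective ℚ)] at h1
    simp [h1] at hp
  exact ⟨s, p, hp, by rw [← h1]; field_simp, by rw [← h2]; field_simp⟩

lemma div (hA : ReducesTo ζ A z) (hB : ReducesTo ζ B w) (hw : w ≠ 0) :
    ReducesTo ζ (A / B) (z / w) := by
  simpa only [div_eq_mul_inv] using hA.mul (hB.inv hw)

lemma sum {ι : Type*} (s : Finset ι) {f : ι → RatFunc ℚ} {g : ι → ℂ}
    (h : ∀ i ∈ s, ReducesTo ζ (f i) (g i)) : ReducesTo ζ (∑ i ∈ s, f i) (∑ i ∈ s, g i) := by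
  classical
  induction s using Finset.induction_on with
  | empty => simpa using zero
  | insert i s hi ih =>
    rw [Finset.sum_insert hi, Finset.sum_insert hi]
    exact (h i (by simp)).add (ih fun j hj => h j (by simp [hj]))

lemma prod {ι : Type*} (s : Finset ι) {f : ι → RatFunc ℚ} {g : ι → ℂ}
    (h : ∀ i ∈ s, ReducesTo ζ (f i) (g i)) : ReducesTo ζ (∏ i ∈ s, f i) (∏ i ∈ s, g i) := by
  classical
  induction s using Finset.induction_on with
  | empty => simpa using one
  | insert i s hi ih =>
    rw [Finset.prod_insert hi, Finset.prod_insert hi]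
    exact (h i (by simp)).mul (ih fun j hj => h j (by simp [hj]))

lemma qPochhammer (hA : ReducesTo ζ A z) (hB : ReducesTo ζ B w) (k : ℕ) :
    ReducesTo ζ (qPochhammer A B k) (qPochhammer z w k) :=
  prod _ fun _ _ => one.sub (hA.mul (hB.pow _))

/-- A rational function vanishing at `ζ` is a multiple of the minimal polynomial of `ζ`. -/
lemma exists_eq_minpoly_mul (hA : ReducesTo ζ A 0) :
    ∃ B z, A = algebraMap _ _ (minpoly ℚ ζ) * B ∧ ReducesTo ζ B z := by
  obtain ⟨p, s, hs, h1, h2⟩ := hA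
  rw [mul_zero] at h2
  obtain ⟨r, rfl⟩ := minpoly.dvd ℚ ζ h2.symm
  have hs' : algebraMap ℚ[X] (RatFunc ℚ) s ≠ 0 := by
    rw [Ne, map_eq_zero_iff _ (RatFunc.algebraMap_injective ℚ)]
    rintro rfl
    simp at hs
  refine ⟨algebraMap _ _ r / algebraMap _ _ s, _, ?_, (of_polynomial r).div (of_polynomial s) hs⟩
  rw [map_mul] at h1
  field_simp
  rw [mul_comm, h1]

end ReducesTo

/-- `A - B` is the `k`-th power of the minimal polynomial of `ζ` times a rational function
regular at `ζ`. -/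
def LocalCongr (ζ : ℂ) (k : ℕ) (A B : RatFunc ℚ) : Prop :=
  ∃ C z, A - B = algebraMap _ _ (minpoly ℚ ζ) ^ k * C ∧ ReducesTo ζ C z

namespace LocalCongr

variable {ζ : ℂ} {k : ℕ} {A B C D : RatFunc ℚ}

/-- A denominator not vanishing at ζ is coprime to the irreducible minimal polynomial, so the power
must divide the reduced numerator. -/
lemma ratFuncCongr (hζ : IsIntegral ℚ ζ) (h : LocalCongr ζ k A B) :
    RatFuncCongr (minpoly ℚ ζ ^ k) A B := by
  obtain ⟨C, z, h, p, s, hs, h1, -⟩ := h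
  unfold RatFuncCongr
  rw [h]
  set D := algebraMap ℚ[X] (RatFunc ℚ) (minpoly ℚ ζ) ^ k * C with hD
  have hcop : IsCoprime (minpoly ℚ ζ ^ k) s := by
    refine IsCoprime.pow_left (((minpoly.irreducible hζ).coprime_iff_not_dvd).2 fun hd => hs ?_)
    obtain ⟨r, rfl⟩ := hd
    simp
  refine hcop.dvd_of_dvd_mul_right ⟨p * D.denom, ?_⟩
  apply RatFunc.algebraMap_injective ℚ
  have hden : algebraMap ℚ[X] (RatFunc ℚ) D.denom ≠ 0 := RatFunc.algebraMap_ne_zero D.denom_ne_zero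
  have hnum : algebraMap ℚ[X] (RatFunc ℚ) D.num = D * algebraMap _ _ D.denom := by
    rw [← div_eq_iff hden, RatFunc.num_div_denom]
  rw [map_mul, map_mul, map_mul, hnum, ← h1, map_pow, hD]
  ring

lemma refl : LocalCongr ζ k A A := ⟨0, 0, by simp, ReducesTo.zero⟩

lemma trans (h : LocalCongr ζ k A B) (h' : LocalCongr ζ k B C) : LocalCongr ζ k A C := by
  obtain ⟨E, z, h, hE⟩ := h
  obtain ⟨E', z', h', hE'⟩ := h'
  exact ⟨E + E', _, by rw [mul_add, ← h, ← h']; ring, hE.add hE'⟩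

lemma add (h : LocalCongr ζ k A B) (h' : LocalCongr ζ k C D) :
    LocalCongr ζ k (A + C) (B + D) := by
  obtain ⟨E, z, h, hE⟩ := h
  obtain ⟨E', z', h', hE'⟩ := h'
  exact ⟨E + E', _, by rw [mul_add, ← h, ← h']; ring, hE.add hE'⟩

lemma mul_right {z : ℂ} (h : LocalCongr ζ k A B) (hC : ReducesTo ζ C z) :
    LocalCongr ζ k (A * C) (B * C) := by
  obtain ⟨E, z, h, hE⟩ := h
  exact ⟨E * C, _, by rw [← mul_assoc, ← h]; ring, hE.mul hC⟩

lemma sum {ι : Type*} (s : Finset ι) {f g : ι → RatFunc ℚ}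
    (h : ∀ i ∈ s, LocalCongr ζ k (f i) (g i)) : LocalCongr ζ k (∑ i ∈ s, f i) (∑ i ∈ s, g i) := by
  classical
  induction s using Finset.induction_on with
  | empty => exact refl
  | insert i s hi ih =>
    rw [Finset.sum_insert hi, Finset.sum_insert hi]
    exact (h i (by simp)).add (ih fun j hj => h j (by simp [hj]))

end LocalCongr

/-! ### Reduction of polynomials in u -/

section CoeffwiseReduction

variable {ζ : ℂ}

/-- Coefficientwise reduction of polynomials over `ℚ(q)`. -/
def PolyReducesTo (ζ : ℂ) (f : (RatFunc ℚ)[X]) (g : ℂ[X]) : Prop :=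
  ∀ i, ReducesTo ζ (f.coeff i) (g.coeff i)

namespace PolyReducesTo

variable {f f' : (RatFunc ℚ)[X]} {g g' : ℂ[X]} {A : RatFunc ℚ} {z : ℂ}

lemma C (h : ReducesTo ζ A z) : PolyReducesTo ζ (C A) (C z) := by
  intro i
  rw [coeff_C, coeff_C]
  split_ifs
  exacts [h, ReducesTo.zero]

lemma X : PolyReducesTo ζ X X := by
  intro i
  rw [coeff_X, coeff_X]
  split_ifs
  exacts [ReducesTo.one, ReducesTo.zero]

lemma add (h : PolyReducesTo ζ f g) (h' : PolyReducesTo ζ f' g') :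
    PolyReducesTo ζ (f + f') (g + g') := fun i => by
  rw [coeff_add, coeff_add]
  exact (h i).add (h' i)

lemma mul (h : PolyReducesTo ζ f g) (h' : PolyReducesTo ζ f' g') :
    PolyReducesTo ζ (f * f') (g * g') := fun i => by
  rw [coeff_mul, coeff_mul]
  exact ReducesTo.sum _ fun x _ => (h x.1).mul (h' x.2)

lemma sum {ι : Type*} (s : Finset ι) {f : ι → (RatFunc ℚ)[X]} {g : ι → ℂ[X]}
    (h : ∀ i ∈ s, PolyReducesTo ζ (f i) (g i)) :
    PolyReducesTo ζ (∑ i ∈ s, f i) (∑ i ∈ s, g i) := fun j => by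
  rw [finsetSum_coeff, finsetSum_coeff]
  exact ReducesTo.sum _ fun i hi => h i hi j

lemma prod {ι : Type*} (s : Finset ι) {f : ι → (RatFunc ℚ)[X]} {g : ι → ℂ[X]}
    (h : ∀ i ∈ s, PolyReducesTo ζ (f i) (g i)) :
    PolyReducesTo ζ (∏ i ∈ s, f i) (∏ i ∈ s, g i) := by
  classical
  induction s using Finset.induction_on with
  | empty => simpa using C (ζ := ζ) ReducesTo.one
  | insert i s hi ih =>
    rw [Finset.prod_insert hi, Finset.prod_insert hi]
    exact (h i (by simp)).mul (ih fun j hj => h j (by simp [hj]))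

/-- Second-order Taylor expansion at `0`, with regular remainder. -/
lemma exists_taylor (h : PolyReducesTo ζ f g) (hA : ReducesTo ζ A z) :
    ∃ B w, f.eval A = f.coeff 0 + f.coeff 1 * A + A ^ 2 * B ∧ ReducesTo ζ B w := by
  refine ⟨f.divX.divX.eval A, ∑ i ∈ Finset.range (f.divX.divX.natDegree + 1),
    g.coeff (i + 2) * z ^ i, ?_, ?_⟩
  · have e1 := congrArg (eval A) (divX_mul_X_add f)
    have e2 := congrArg (eval A) (divX_mul_X_add f.divX)
    simp only [eval_add, eval_mul, eval_X, eval_C, coeff_divX, zero_add] at e1 e2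
    rw [← e1, ← e2]
    ring
  · rw [eval_eq_sum_range]
    refine ReducesTo.sum _ fun i _ => ?_
    rw [coeff_divX, coeff_divX]
    exact (h _).mul (hA.pow i)

end PolyReducesTo

end CoeffwiseReduction

/-! ### Regularity of the terms at ζ -/

lemma qWeight_reducesTo {ζ : ℂ} {k : ℕ} (h : ∀ i, 1 ≤ i → i ≤ k → ζ ^ (4 * i) ≠ 1) :
    ReducesTo ζ (qWeight RatFunc.X k) (qWeight ζ k) := by
  have hX := ReducesTo.X (ζ := ζ)
  refine ((hX.pow 2).qPochhammer (hX.pow 4) k).div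
    ((((hX.pow 2).qPochhammer (hX.pow 2) k).pow 2).mul ((hX.pow 4).qPochhammer (hX.pow 4) k)) ?_
  have h4 : qPochhammer (ζ ^ 4) (ζ ^ 4) k ≠ 0 := by
    refine Finset.prod_ne_zero_iff.2 fun i hi => sub_ne_zero.2 fun e => ?_
    refine h (i + 1) (by omega) (Finset.mem_range.1 hi) ?_
    rw [e]; ring
  have h2 : qPochhammer (ζ ^ 2) (ζ ^ 2) k ≠ 0 := by
    refine Finset.prod_ne_zero_iff.2 fun i hi => sub_ne_zero.2 fun e => ?_
    refine h (i + 1) (by omega) (Finset.mem_range.1 hi) ?_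
    rw [show 4 * (i + 1) = (2 + 2 * i) * 2 by ring, pow_mul, pow_add, pow_mul ζ 2 i, ← e, one_pow]
  exact mul_ne_zero (pow_ne_zero 2 h2) h4

lemma cTerm_eq {F : Type*} [Field F] (q : F) (k : ℕ) :
    cTerm q k = qPochhammer q (q ^ 2) k ^ 2 * qWeight q k * q ^ (2 * k) := by
  simp only [cTerm, qWeight]; ring

lemma cTerm_reducesTo {ζ : ℂ} {k : ℕ} (h : ∀ i, 1 ≤ i → i ≤ k → ζ ^ (4 * i) ≠ 1) :
    ReducesTo ζ (cTerm RatFunc.X k) (cTerm ζ k) := by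
  have hX := ReducesTo.X (ζ := ζ)
  rw [cTerm_eq, cTerm_eq]
  exact (((hX.qPochhammer (hX.pow 2) k).pow 2).mul (qWeight_reducesTo h)).mul (hX.pow _)

lemma seriesPoly_reducesTo {ζ : ℂ} {N : ℕ} (h : ∀ i, 1 ≤ i → i ≤ N → ζ ^ (4 * i) ≠ 1) :
    PolyReducesTo ζ (seriesPoly RatFunc.X (N + 1)) (seriesPoly ζ (N + 1)) := by
  have hX := ReducesTo.X (ζ := ζ)
  refine PolyReducesTo.sum _ fun k hk => ?_
  have hk := Finset.mem_range.1 hk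
  refine (PolyReducesTo.C ((qWeight_reducesTo fun i h1 h2 => h i h1 (by omega)).mul
    (hX.pow _))).mul (PolyReducesTo.prod _ fun i _ => ?_)
  exact (PolyReducesTo.C ((ReducesTo.one.sub (hX.pow _)).pow 2)).add
    ((PolyReducesTo.C (hX.pow _)).mul PolyReducesTo.X)

lemma ratFunc_X_pow_ne_one {j : ℕ} (hj : j ≠ 0) : (RatFunc.X : RatFunc ℚ) ^ j ≠ 1 := by
  rw [← RatFunc.algebraMap_X, ← map_pow, ← map_one (algebraMap ℚ[X] (RatFunc ℚ))]
  intro e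
  have := congrArg natDegree (RatFunc.algebraMap_injective ℚ e)
  simp at this
  exact hj this

lemma qInt_mul_one_sub {F : Type*} [Field F] (q : F) (m : ℕ) : qInt q m * (1 - q) = 1 - q ^ m :=
  geom_sum_mul_neg q m

lemma qInt_sq_mul_sum {F : Type*} [Field F] {q : F} (hq : 1 - q ≠ 0) (n M : ℕ) :
    qInt q n ^ 2 * ∑ k ∈ Finset.Icc 1 M, q ^ (4 * k - 2) / qInt q (4 * k - 2) ^ 2 =
      (1 - q ^ n) ^ 2 * ∑ k ∈ Finset.range M, q ^ (4 * k + 2) / (1 - q ^ (4 * k + 2)) ^ 2 := by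
  have hI : ∀ m, qInt q m = (1 - q ^ m) / (1 - q) := fun m =>
    eq_div_of_mul_eq hq (qInt_mul_one_sub q m)
  have hs : Finset.Icc 1 M = Finset.Ico (0 + 1) (M + 1) := by ext; simp
  rw [hs, ← Finset.sum_Ico_add', ← Finset.range_eq_Ico, Finset.mul_sum, Finset.mul_sum]
  refine Finset.sum_congr rfl fun k _ => ?_
  rw [show 4 * (k + 1) - 2 = 4 * k + 2 by omega, hI, hI]
  field_simp

/-! ### The truncated convolution and the case n ≡ 3 (mod 4) -/

section RootOfUnity

variable {ζ : ℂ} {n : ℕ}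

lemma pow_four_mul_ne_one (hζ : IsPrimitiveRoot ζ n) (hn : Odd n) {i : ℕ} (h1 : 1 ≤ i)
    (h2 : i < n) : ζ ^ (4 * i) ≠ 1 := by
  intro e
  have hd := hζ.dvd_of_pow_eq_one _ e
  have hc : Nat.Coprime n 4 := by
    simpa using (Nat.coprime_two_right.2 hn).pow_right 2
  exact absurd (Nat.le_of_dvd (by omega) (hc.dvd_of_dvd_mul_left hd)) (by omega)

/-- Past the middle, `(q;q^2)_k` and `(q^2;q^4)_k` both contain, at index `N`, a factor vanishing at
ζ. The first is squared, which gives order three, while the denominator stays nonzero since `k < n`.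
-/
lemma cTerm_localCongr_zero {N k : ℕ} (hζ : IsPrimitiveRoot ζ (2 * N + 1)) (h1 : N < k)
    (h2 : k < 2 * N + 1) : LocalCongr ζ 3 (cTerm RatFunc.X k) 0 := by
  have hX := ReducesTo.X (ζ := ζ)
  have z1 : qPochhammer ζ (ζ ^ 2) k = 0 := by
    refine Finset.prod_eq_zero (Finset.mem_range.2 h1) ?_
    rw [show ζ * (ζ ^ 2) ^ N = ζ ^ (2 * N + 1) by ring, hζ.pow_eq_one, sub_self]
  have z2 : qPochhammer (ζ ^ 2) (ζ ^ 4) k = 0 := by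
    refine Finset.prod_eq_zero (Finset.mem_range.2 h1) ?_
    rw [show ζ ^ 2 * (ζ ^ 4) ^ N = (ζ ^ (2 * N + 1)) ^ 2 by ring, hζ.pow_eq_one, one_pow, sub_self]
  have r1 := hX.qPochhammer (hX.pow 2) k
  have r2 := (hX.pow 2).qPochhammer (hX.pow 4) k
  rw [z1] at r1
  rw [z2] at r2
  have r3 : ReducesTo ζ ((qPochhammer (RatFunc.X ^ 2) (RatFunc.X ^ 2) k ^ 2 *
      qPochhammer (RatFunc.X ^ 4) (RatFunc.X ^ 4) k)⁻¹) _ :=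
    ((((hX.pow 2).qPochhammer (hX.pow 2) k).pow 2).mul
      ((hX.pow 4).qPochhammer (hX.pow 4) k)).inv ?_
  · obtain ⟨B, w, hB, rB⟩ := r1.exists_eq_minpoly_mul
    obtain ⟨B', w', hB', rB'⟩ := r2.exists_eq_minpoly_mul
    refine ⟨B ^ 2 * B' * (qPochhammer (RatFunc.X ^ 2) (RatFunc.X ^ 2) k ^ 2 *
      qPochhammer (RatFunc.X ^ 4) (RatFunc.X ^ 4) k)⁻¹ * RatFunc.X ^ (2 * k), _, ?_,
      (((rB.pow 2).mul rB').mul r3).mul (hX.pow _)⟩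
    rw [cTerm, hB, hB', sub_zero, div_eq_mul_inv]
    ring
  · have h : ∀ i < k, ζ ^ (4 * (i + 1)) ≠ 1 := fun i hi =>
      pow_four_mul_ne_one hζ (by simp) (by omega) (by omega)
    refine mul_ne_zero (pow_ne_zero 2 ?_) ?_
    · refine Finset.prod_ne_zero_iff.2 fun i hi => sub_ne_zero.2 fun e => ?_
      refine h i (Finset.mem_range.1 hi) ?_
      rw [show 4 * (i + 1) = (2 + 2 * i) * 2 by ring, pow_mul, pow_add, pow_mul ζ 2 i, ← e, one_pow]
    · refine Finset.prod_ne_zero_iff.2 fun i hi => sub_ne_zero.2 fun e => ?_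
      refine h i (Finset.mem_range.1 hi) ?_
      rw [e]; ring

/-- The truncated Cauchy square is congruent to the square of the half-length sum. -/
lemma doubleSum_localCongr {N : ℕ} (hζ : IsPrimitiveRoot ζ (2 * N + 1)) :
    LocalCongr ζ 3 (∑ k ∈ Finset.range (2 * N + 1), ∑ j ∈ Finset.range (k + 1),
        cTerm (RatFunc.X : RatFunc ℚ) j * cTerm (RatFunc.X : RatFunc ℚ) (k - j))
      ((∑ k ∈ Finset.range (N + 1), cTerm (RatFunc.X : RatFunc ℚ) k) ^ 2) := by
  have hred : ∀ k < 2 * N + 1, ReducesTo ζ (cTerm RatFunc.X k) (cTerm ζ k) := fun k hk =>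
    cTerm_reducesTo fun i h1 h2 => pow_four_mul_ne_one hζ (by simp) h1 (by omega)
  -- The triangle j + l ≤ 2N contains the whole square j, l ≤ N; any other pair has an index above
  -- N.
  rw [Finset.sum_range_diag_flip (2 * N + 1)
    (fun j l => cTerm (RatFunc.X : RatFunc ℚ) j * cTerm (RatFunc.X : RatFunc ℚ) l),
    ← Finset.sum_range_add_sum_Ico _ (show N + 1 ≤ 2 * N + 1 by omega), pow_two, Finset.sum_mul,
    ← add_zero (∑ i ∈ Finset.range (N + 1), _ * _)]
  refine (LocalCongr.sum _ fun j hj => ?_).add ?_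
  · have hj := Finset.mem_range.1 hj
    rw [← Finset.sum_range_add_sum_Ico _ (show N + 1 ≤ 2 * N + 1 - j by omega), ← Finset.mul_sum]
    nth_rewrite 2 [← add_zero (cTerm RatFunc.X j * ∑ i ∈ Finset.range (N + 1), cTerm RatFunc.X i)]
    refine LocalCongr.refl.add ?_
    rw [← Finset.sum_const_zero (s := Finset.Ico (N + 1) (2 * N + 1 - j))]
    refine LocalCongr.sum _ fun l hl => ?_
    have hl := Finset.mem_Ico.1 hl
    have := (cTerm_localCongr_zero hζ (k := l) (by omega) (by omega)).mul_right
      (hred j (by omega))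
    rwa [zero_mul, mul_comm] at this
  · rw [← Finset.sum_const_zero (s := Finset.Ico (N + 1) (2 * N + 1))]
    refine LocalCongr.sum _ fun j hj => ?_
    have hj := Finset.mem_Ico.1 hj
    rw [← Finset.sum_const_zero (s := Finset.range (2 * N + 1 - j))]
    refine LocalCongr.sum _ fun l hl => ?_
    have hl := Finset.mem_range.1 hl
    simpa using (cTerm_localCongr_zero hζ (k := j) (by omega) (by omega)).mul_right
      (hred l (by omega))

lemma exists_one_sub_X_pow_eq (hζ : IsPrimitiveRoot ζ n) :
    ∃ E w, (1 - RatFunc.X ^ n : RatFunc ℚ) = algebraMap _ _ (minpoly ℚ ζ) * E ∧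
      ReducesTo ζ E w := by
  have h : ReducesTo ζ (1 - RatFunc.X ^ n) (1 - ζ ^ n) := ReducesTo.one.sub (ReducesTo.X.pow n)
  rw [hζ.pow_eq_one, sub_self] at h
  exact h.exists_eq_minpoly_mul

lemma two_sub_sub_inv {F : Type*} [Field F] {a : F} (ha : a ≠ 0) :
    2 - a - a⁻¹ = -((1 - a) ^ 2 * a⁻¹) := by
  field_simp
  ring

lemma sum_sq_localCongr_zero {j : ℕ} (hζ : IsPrimitiveRoot ζ (4 * j + 3)) :
    LocalCongr ζ 3 ((∑ k ∈ Finset.range (2 * j + 2), cTerm (RatFunc.X : RatFunc ℚ) k) ^ 2) 0 := by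
  have hX := ReducesTo.X (ζ := ζ)
  have hX0 : (RatFunc.X : RatFunc ℚ) ≠ 0 := RatFunc.X_ne_zero
  have ha := pow_ne_zero (4 * j + 3) hX0
  have hp := seriesPoly_reducesTo (ζ := ζ) (N := 2 * j + 1) fun i h1 h2 =>
    pow_four_mul_ne_one hζ ⟨2 * j + 1, by ring⟩ h1 (by omega)
  have hinv : ReducesTo ζ ((RatFunc.X ^ (4 * j + 3))⁻¹) _ := (hX.pow _).inv (by
    rw [hζ.pow_eq_one]; exact one_ne_zero)
  obtain ⟨E, w, hE, rE⟩ := exists_one_sub_X_pow_eq hζ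
  obtain ⟨B, v, hB, rB⟩ := hp.exists_taylor
    (A := 2 - RatFunc.X ^ (4 * j + 3) - (RatFunc.X ^ (4 * j + 3))⁻¹)
    ((ReducesTo.two.sub (hX.pow _)).sub hinv)
  rw [seriesPoly_eval_odd hX0 (fun i h1 h2 => ratFunc_X_pow_ne_one (by omega)) j le_rfl,
    coeff_zero_seriesPoly, two_sub_sub_inv ha, hE] at hB
  set S := ∑ k ∈ Finset.range (2 * j + 2), cTerm (RatFunc.X : RatFunc ℚ) k
  set Y : RatFunc ℚ := (RatFunc.X ^ (4 * j + 3))⁻¹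
  set f1 := (seriesPoly (RatFunc.X : RatFunc ℚ) (2 * j + 1 + 1)).coeff 1
  set P := algebraMap ℚ[X] (RatFunc ℚ) (minpoly ℚ ζ)
  -- The value at `a = q^n` is zero and `u` has a factor `P^2`, so `P^2` divides `S`; squaring gives
  -- more than `P^3`.
  have hS : S = P ^ 2 * (f1 * E ^ 2 * Y - P ^ 2 * (E ^ 2 * Y) ^ 2 * B) := by
    linear_combination -hB
  refine ⟨P * (f1 * E ^ 2 * Y - P ^ 2 * (E ^ 2 * Y) ^ 2 * B) ^ 2, _, by rw [hS]; ring,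
    (ReducesTo.of_polynomial _).mul (((((hp 1).mul (rE.pow 2)).mul hinv).sub
      ((((ReducesTo.of_polynomial _).pow 2).mul (((rE.pow 2).mul hinv).pow 2)).mul rB)).pow 2)⟩

end RootOfUnity

/-! ### Factorization at ζ and the case n ≡ 1 (mod 4) -/

section RootOfUnity

variable {ζ : ℂ} {M : ℕ}

lemma doubleStepProd_ne_zero (hζ : IsPrimitiveRoot ζ (4 * M + 1)) :
    doubleStepProd ζ ζ M ≠ 0 := by
  have h0 : ζ ≠ 0 := hζ.ne_zero (by simp)
  refine Finset.prod_ne_zero_iff.2 fun k hk => ?_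
  have hk := Finset.mem_range.1 hk
  refine mul_ne_zero (sub_ne_zero.2 fun e => ?_) (sub_ne_zero.2 fun e => ?_)
  · refine hζ.pow_ne_one_of_pos_of_lt (l := 4 * k + 3) (by omega) (by omega) ?_
    rw [e]; ring
  · refine hζ.pow_ne_one_of_pos_of_lt (l := 4 * k + 1) (by omega) (by omega) ?_
    rw [e]; field_simp; ring

/-- The factor of index `M - 1 - j` contains `1 - ζ^(4M+1)`. These zeros match the odd-case zeros of
the series. -/
lemma doubleStepProd_eq_zero (hζ : IsPrimitiveRoot ζ (4 * M + 1)) {j : ℕ} (hj : j < M) :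
    doubleStepProd ζ (ζ ^ (4 * j + 3)) M = 0 := by
  refine Finset.prod_eq_zero (i := M - 1 - j) (Finset.mem_range.2 (by omega)) ?_
  rw [← pow_add, show 4 * j + 3 + (4 * (M - 1 - j) + 2) = 4 * M + 1 by omega, hζ.pow_eq_one,
    sub_self, zero_mul]

/-- The square of this recurrence is `seriesPoly_eval_step` at `m = 2j`. -/
lemma doubleStepProd_step (hζ : IsPrimitiveRoot ζ (4 * M + 1)) {j : ℕ} (hj : j < M) :
    (1 - ζ ^ (4 * j + 4)) * doubleStepProd ζ (ζ ^ (4 * j + 5)) M =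
      ζ * (1 - ζ ^ (4 * j + 2)) * doubleStepProd ζ (ζ ^ (4 * j + 1)) M := by
  have h0 : ζ ≠ 0 := hζ.ne_zero (by simp)
  have h := doubleStepProd_shift h0 (pow_ne_zero (4 * j + 1) h0) M
  have h1 : ζ ^ (4 * j + 1) * ζ ^ (4 * M + 2) = ζ ^ (4 * j + 2) := by
    rw [show ζ ^ (4 * j + 1) * ζ ^ (4 * M + 2) = ζ ^ (4 * j + 2) * ζ ^ (4 * M + 1) by ring,
      hζ.pow_eq_one, mul_one]
  have h2 : ζ * ζ ^ (4 * M) = 1 := by rw [← hζ.pow_eq_one]; ring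
  have h3 : 1 - ζ ^ (4 * j + 3) ≠ 0 :=
    sub_ne_zero.2 (hζ.pow_ne_one_of_pos_of_lt (by omega) (by omega)).symm
  rw [h1, ← pow_add, ← pow_add] at h
  refine mul_left_cancel₀ (mul_ne_zero h3 (pow_ne_zero (4 * j + 5) h0)) ?_
  linear_combination -ζ * h - doubleStepProd ζ (ζ ^ (4 * j + 5)) M *
    ζ ^ (4 * j + 5) * (1 - ζ ^ (4 * j + 3)) * h2

/-- Two parameters give the same u only if they are equal or mutually inverse. -/
lemma injOn_two_sub_pow (hζ : IsPrimitiveRoot ζ (4 * M + 1)) :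
    Set.InjOn (fun m : ℕ => 2 - ζ ^ (2 * m + 1) - (ζ ^ (2 * m + 1))⁻¹)
      (Finset.range (2 * M + 1)) := by
  have h0 : ζ ≠ 0 := hζ.ne_zero (by simp)
  intro m hm m' hm' e
  have hm : m < 2 * M + 1 := by simpa using hm
  have hm' : m' < 2 * M + 1 := by simpa using hm'
  wlog hle : m ≤ m' generalizing m m'
  · exact (this ‹_› ‹_› e.symm ‹_› ‹_› (by omega)).symm
  have ha := pow_ne_zero (2 * m + 1) h0
  have hb := pow_ne_zero (2 * m' + 1) h0
  have key : (ζ ^ (2 * m + 1) - ζ ^ (2 * m' + 1)) *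
      (ζ ^ (2 * m + 1) * ζ ^ (2 * m' + 1) - 1) = 0 := by
    simp only at e
    generalize ζ ^ (2 * m + 1) = a at *
    generalize ζ ^ (2 * m' + 1) = b at *
    field_simp at e
    linear_combination -e
  rcases mul_eq_zero.1 key with h | h
  · have h1 : ζ ^ (2 * (m' - m)) = 1 := by
      refine mul_left_cancel₀ ha ?_
      rw [mul_one, ← pow_add, show 2 * m + 1 + 2 * (m' - m) = 2 * m' + 1 by omega]
      exact (sub_eq_zero.1 h).symm
    by_contra hne
    exact hζ.pow_ne_one_of_pos_of_lt (by omega) (by omega) h1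
  · rw [sub_eq_zero, ← pow_add] at h
    have hd := hζ.dvd_of_pow_eq_one _ h
    rw [show 2 * m + 1 + (2 * m' + 1) = 2 * (m + m' + 1) by ring] at hd
    have hc : Nat.Coprime (4 * M + 1) 2 := Nat.coprime_two_right.2 ⟨2 * M, by ring⟩
    -- Inverse parameters need `m + m' + 1 ≥ 4M + 1`, possible only for `m = m' = 2M`, the node u =
    -- 0.
    have := Nat.le_of_dvd (by omega) (hc.dvd_of_dvd_mul_left hd)
    omega

/-- At a primitive root of unity of order `4M + 1` the truncated series factors completely. -/
lemma seriesPoly_eq_C_mul_doubleStepPoly (hζ : IsPrimitiveRoot ζ (4 * M + 1)) :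
    seriesPoly ζ (2 * M + 1) =
      C ((doubleStepProd ζ ζ M ^ 2)⁻¹) * doubleStepPoly ζ M := by
  have h0 : ζ ≠ 0 := hζ.ne_zero (by simp)
  have h4 : ∀ i, 1 ≤ i → i ≤ 2 * M → ζ ^ (4 * i) ≠ 1 := fun i h1 h2 =>
    pow_four_mul_ne_one hζ ⟨2 * M, by ring⟩ h1 (by omega)
  have hH := pow_ne_zero 2 (doubleStepProd_ne_zero hζ)
  have heven : ∀ j ≤ M,
      (seriesPoly ζ (2 * M + 1)).eval (2 - ζ ^ (4 * j + 1) - (ζ ^ (4 * j + 1))⁻¹) =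
        (doubleStepProd ζ ζ M ^ 2)⁻¹ * doubleStepProd ζ (ζ ^ (4 * j + 1)) M ^ 2 := by
    intro j
    induction j with
    | zero =>
      intro _
      simpa [inv_mul_cancel₀ hH] using seriesPoly_eval_initial h0 (2 * M)
    | succ j ih =>
      intro hj
      have hs := seriesPoly_eval_step h0 (m := 2 * j) (by omega) h4
      have hd := doubleStepProd_step hζ (j := j) hj
      rw [show 2 * (2 * j) = 4 * j by ring, ih (by omega)] at hs
      have hne : 1 - ζ ^ (4 * j + 4) ≠ 0 :=
        sub_ne_zero.2 (Ne.symm (by simpa [mul_add] using h4 (j + 1) (by omega) (by omega)))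
      refine mul_left_cancel₀ (pow_ne_zero 2 hne) (hs.trans ?_)
      rw [mul_left_comm ((1 - ζ ^ (4 * j + 4)) ^ 2), ← mul_pow (1 - ζ ^ (4 * j + 4)),
        show 4 * (j + 1) + 1 = 4 * j + 5 by ring, hd]
      ring
  -- Both sides have degree at most `2M` and agree at `2M + 1` distinct nodes.
  refine eq_of_degrees_lt_of_eval_index_eq (Finset.range (2 * M + 1)) (injOn_two_sub_pow hζ)
    ?_ ?_ fun m hm => ?_
  · rw [Finset.card_range]
    exact degree_le_natDegree.trans_lt
      (by exact_mod_cast Nat.lt_succ_of_le (natDegree_seriesPoly_le ζ (2 * M)))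
  · rw [Finset.card_range]
    exact degree_le_natDegree.trans_lt (by
      exact_mod_cast Nat.lt_succ_of_le ((natDegree_C_mul_le _ _).trans
        (natDegree_doubleStepPoly_le ζ M)))
  · have hm := Finset.mem_range.1 hm
    rw [eval_mul, eval_C, eval_doubleStepPoly ζ M (pow_ne_zero _ h0)]
    obtain ⟨j, rfl | rfl⟩ : ∃ j, m = 2 * j ∨ m = 2 * j + 1 := ⟨m / 2, by omega⟩
    · rw [show 2 * (2 * j) + 1 = 4 * j + 1 by ring]
      exact heven j (by omega)
    · rw [show 2 * (2 * j + 1) + 1 = 4 * j + 3 by ring,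
        seriesPoly_eval_odd h0 h4 j (by omega), doubleStepProd_eq_zero hζ (by omega)]
      simp

lemma pow_four_mul_add_two_ne_one (hζ : IsPrimitiveRoot ζ (4 * M + 1)) {k : ℕ} (hk : k < M) :
    ζ ^ (4 * k + 2) ≠ 1 :=
  hζ.pow_ne_one_of_pos_of_lt (by omega) (by omega)

lemma coeff_one_seriesPoly (hζ : IsPrimitiveRoot ζ (4 * M + 1)) :
    (seriesPoly ζ (2 * M + 1)).coeff 1 = (seriesPoly ζ (2 * M + 1)).coeff 0 *
      (2 * ∑ k ∈ Finset.range M, ζ ^ (4 * k + 2) / (1 - ζ ^ (4 * k + 2)) ^ 2) := by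
  rw [seriesPoly_eq_C_mul_doubleStepPoly hζ, coeff_C_mul, coeff_C_mul,
    coeff_one_doubleStepPoly fun k hk => pow_four_mul_add_two_ne_one hζ hk, mul_assoc]

lemma sum_sq_localCongr (hζ : IsPrimitiveRoot ζ (4 * M + 1)) :
    LocalCongr ζ 3 ((∑ k ∈ Finset.range (2 * M + 1), cTerm (RatFunc.X : RatFunc ℚ) k) ^ 2)
      ((qPochhammer (RatFunc.X ^ 2) (RatFunc.X ^ 4) M ^ 2 /
        qPochhammer (RatFunc.X ^ 4) (RatFunc.X ^ 4) M ^ 2 * RatFunc.X ^ (2 * M)) ^ 2 *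
        (1 + 4 * ((1 - RatFunc.X ^ (4 * M + 1)) ^ 2 * ∑ k ∈ Finset.range M,
          (RatFunc.X : RatFunc ℚ) ^ (4 * k + 2) / (1 - RatFunc.X ^ (4 * k + 2)) ^ 2))) := by
  have hX := ReducesTo.X (ζ := ζ)
  have hX0 : (RatFunc.X : RatFunc ℚ) ≠ 0 := RatFunc.X_ne_zero
  have ha := pow_ne_zero (4 * M + 1) hX0
  have hp := seriesPoly_reducesTo (ζ := ζ) (N := 2 * M) fun i h1 h2 =>
    pow_four_mul_ne_one hζ ⟨2 * M, by ring⟩ h1 (by omega)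
  have rY : ReducesTo ζ ((RatFunc.X ^ (4 * M + 1))⁻¹) 1 := by
    simpa [hζ.pow_eq_one] using (hX.pow (4 * M + 1)).inv (by simp [hζ.pow_eq_one])
  obtain ⟨E, w, hE, rE⟩ := exists_one_sub_X_pow_eq hζ
  obtain ⟨B, v, hB, rB⟩ := hp.exists_taylor
    (A := 2 - RatFunc.X ^ (4 * M + 1) - (RatFunc.X ^ (4 * M + 1))⁻¹)
    ((ReducesTo.two.sub (hX.pow _)).sub rY)
  have rT : ReducesTo ζ (∑ k ∈ Finset.range M,
      (RatFunc.X : RatFunc ℚ) ^ (4 * k + 2) / (1 - RatFunc.X ^ (4 * k + 2)) ^ 2) _ :=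
    ReducesTo.sum _ fun k hk => (hX.pow _).div ((ReducesTo.one.sub (hX.pow _)).pow 2)
      (pow_ne_zero 2 (sub_ne_zero.2
        (pow_four_mul_add_two_ne_one hζ (Finset.mem_range.1 hk)).symm))
  -- At ζ the inverse of `q^n` is 1 and F'(0) = 2T·F(0), so `Y * f1 - 2 * T * S` is divisible by
  -- `P`.
  have rS := hp 0
  have rf1 := hp 1
  rw [coeff_one_seriesPoly hζ] at rf1
  rw [seriesPoly_eval_even hX0 (fun i h1 h2 => ratFunc_X_pow_ne_one (by omega)) M le_rfl,
    two_sub_sub_inv ha, hE] at hB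
  rw [coeff_zero_seriesPoly] at hB rS
  rw [hE]
  set S := ∑ k ∈ Finset.range (2 * M + 1), cTerm (RatFunc.X : RatFunc ℚ) k
  set Y : RatFunc ℚ := (RatFunc.X ^ (4 * M + 1))⁻¹
  set f1 := (seriesPoly (RatFunc.X : RatFunc ℚ) (2 * M + 1)).coeff 1
  set T : RatFunc ℚ := ∑ k ∈ Finset.range M,
    (RatFunc.X : RatFunc ℚ) ^ (4 * k + 2) / (1 - RatFunc.X ^ (4 * k + 2)) ^ 2
  set A : RatFunc ℚ := qPochhammer (RatFunc.X ^ 2) (RatFunc.X ^ 4) M ^ 2 /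
    qPochhammer (RatFunc.X ^ 4) (RatFunc.X ^ 4) M ^ 2 * RatFunc.X ^ (2 * M)
  have rP := ReducesTo.of_polynomial (ζ := ζ) (minpoly ℚ ζ)
  set P := algebraMap ℚ[X] (RatFunc ℚ) (minpoly ℚ ζ)
  have rD := (rY.mul rf1).sub ((ReducesTo.two.mul rT).mul rS)
  rw [one_mul, mul_comm _ (_ * _), sub_self] at rD
  obtain ⟨D, d, hD, rD⟩ := rD.exists_eq_minpoly_mul
  -- Regularity of `A` is read off its Taylor expansion.
  have rA : ReducesTo ζ (S + f1 * -((P * E) ^ 2 * Y) + (-((P * E) ^ 2 * Y)) ^ 2 * B) _ :=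
    have rU := (((rP.mul rE).pow 2).mul rY).neg
    (rS.add (rf1.mul rU)).add ((rU.pow 2).mul rB)
  rw [← hB] at rA
  have rR := ((rE.pow 2).mul rD).add (((rP.mul (rE.pow 4))).mul
    (((ReducesTo.two.mul rT).mul ((rY.mul rf1).sub
      (((((rP.mul rE).pow 2).mul (rY.pow 2)).mul rB)))).sub ((rY.pow 2).mul rB)))
  set R := E ^ 2 * D + P * E ^ 4 *
    (2 * T * (Y * f1 - (P * E) ^ 2 * Y ^ 2 * B) - Y ^ 2 * B)
  -- Since `S` and `A` agree modulo `P^2`, replacing `S` by `A` in the term carrying `(P * E)^2`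
  -- costs only `P^4`.
  have hS : S = A * (1 + 2 * ((P * E) ^ 2 * T)) + P ^ 3 * R := by
    rw [hB]
    linear_combination (P ^ 2 * E ^ 2) * hD
  -- In the square of `hS`, the term `4 A^2 (P E)^4 T^2` is absorbed too, being divisible by `P^4`.
  refine ⟨2 * 2 * A ^ 2 * T ^ 2 * (P * E ^ 4) + 2 * (A * (1 + 2 * ((P * E) ^ 2 * T))) * R +
    P ^ 3 * R ^ 2, _, ?_, ((((((ReducesTo.two.mul ReducesTo.two).mul (rA.pow 2)).mul
      (rT.pow 2)).mul (rP.mul (rE.pow 4))).add ((ReducesTo.two.mul (rA.mul (ReducesTo.one.add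
      (ReducesTo.two.mul (((rP.mul rE).pow 2).mul rT))))).mul rR))).add ((rP.pow 3).mul
      (rR.pow 2))⟩
  rw [hS]
  ring

end RootOfUnity

theorem theorem6 (n : ℕ) (hn : Odd n) :
    (n % 4 = 1 →
      RatFuncCongr (cyclotomic n ℚ ^ 3)
        (∑ k ∈ Finset.range n, ∑ j ∈ Finset.range (k + 1),
          cTerm (RatFunc.X : RatFunc ℚ) j * cTerm (RatFunc.X : RatFunc ℚ) (k - j))
        (qPochhammer ((RatFunc.X : RatFunc ℚ) ^ 2) (RatFunc.X ^ 4) ((n - 1) / 4) ^ 4 /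
            qPochhammer ((RatFunc.X : RatFunc ℚ) ^ 4) (RatFunc.X ^ 4) ((n - 1) / 4) ^ 4 *
          RatFunc.X ^ (n - 1) *
          (1 + 4 * qInt (RatFunc.X : RatFunc ℚ) n ^ 2 *
            ∑ k ∈ Finset.Icc 1 ((n - 1) / 4),
              (RatFunc.X : RatFunc ℚ) ^ (4 * k - 2) /
                qInt (RatFunc.X : RatFunc ℚ) (4 * k - 2) ^ 2))) ∧
    (n % 4 = 3 →
      RatFuncCongr (cyclotomic n ℚ ^ 3)
        (∑ k ∈ Finset.range n, ∑ j ∈ Finset.range (k + 1),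
          cTerm (RatFunc.X : RatFunc ℚ) j * cTerm (RatFunc.X : RatFunc ℚ) (k - j))
        0) := by
  have hζ := Complex.isPrimitiveRoot_exp n hn.pos.ne'
  generalize Complex.exp (2 * Real.pi * Complex.I / n) = ζ at hζ
  have hint : IsIntegral ℚ ζ := (hζ.isIntegral hn.pos).tower_top
  rw [cyclotomic_eq_minpoly_rat hζ hn.pos]
  constructor
  · intro h
    obtain ⟨M, rfl⟩ : ∃ M, n = 4 * M + 1 := ⟨n / 4, by omega⟩
    have hd := doubleSum_localCongr (N := 2 * M) (ζ := ζ)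
    rw [show 2 * (2 * M) + 1 = 4 * M + 1 by ring] at hd
    have hX : (1 - RatFunc.X : RatFunc ℚ) ≠ 0 :=
      sub_ne_zero.2 (by simpa using (ratFunc_X_pow_ne_one one_ne_zero).symm)
    convert ((hd hζ).trans (sum_sq_localCongr hζ)).ratFuncCongr hint using 1
    rw [show 4 * M + 1 - 1 = 4 * M by omega, Nat.mul_div_cancel_left M (by norm_num : 0 < 4),
      mul_assoc 4, qInt_sq_mul_sum hX]
    congr 1
    ring
  · intro h
    obtain ⟨j, rfl⟩ : ∃ j, n = 4 * j + 3 := ⟨n / 4, by omega⟩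
    have hd := doubleSum_localCongr (N := 2 * j + 1) (ζ := ζ)
    rw [show 2 * (2 * j + 1) + 1 = 4 * j + 3 by ring] at hd
    exact ((hd hζ).trans (sum_sq_localCongr_zero hζ)).ratFuncCongr hint
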